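/- Let $n, r \ge 1$ be integers and let $(a_1,b_1),\dots,(a_r,b_r) \in \mathbb{R}^n\times\mathbb{R}^n = \mathbb{R}^{2n}$ be distinct nonzero elements such that the additive subgroup of $\mathbb{R}^{2n}$ generated by $(a_1,b_1),\dots,(a_r,b_r)$ is discrete and $a_h\cdot b_k \in \mathbb{Q}$ for all $h,k \in \{1,\dots,r\}$, where $\cdot$ is the Euclidean inner product on $\mathbb{R}^n$. Let $c_1,\dots,c_r$ be nonzero complex numbers and let $f \in L^2(\mathbb{R}^n)$ be complex valued. If $$\sum_{k=1}^{r} c_k\, e^{2\pi i\, b_k\cdot t} f(t+a_k) = 0 \quad\text{for almost every } t\in\mathbb{R}^n,$$ then $f = 0$ in $L^2(\mathbb{R}^n)$. -/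

import Mathlib

open MeasureTheory

/-! The Gaussian short-time Fourier transform turns the dependency into a twisted convolution
equation on every coset `z + L` of the discrete group `L ≅ ℤ^m`. On each coset the transform is in
`ℓ²`, because Gaussian shifts along `L` have a Gram matrix with Gaussian decay
(`summable_sq_norm_stft`). It then suffices that a nonzero finitely supported element kills no
nonzero `F ∈ ℓ²` (`eq_zero_of_twistedConv_eq_zero`).

That is a dimension count. Twisted translates of `F`, cut off to a large box `Ω`, span a space of
dimension at least a fixed multiple of `|Ω|`. Their convolutions vanish except in a boundary layer
of size `o(|Ω|)`. So some nonzero combination, of finite support, is killed exactly, which unique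
sums in `ℤ^m` forbid. Thus the transform vanishes everywhere, and it is injective. -/

/-! ### Twisted convolution on `ℤ^m` -/

/-- A square matrix whose diagonal entries are bounded below and whose rows are bounded in the
Euclidean norm has rank proportional to its size. -/
theorem sq_mul_card_le_mul_finrank_span {I : Type*} [Fintype I] (u : I → EuclideanSpace ℂ I)
    {δ M : ℝ} (hδ : 0 ≤ δ) (hdiag : ∀ i, δ ≤ ‖u i i‖) (hM : ∀ i, ‖u i‖ ^ 2 ≤ M) :
    δ ^ 2 * Fintype.card I ≤ M * Module.finrank ℂ (Submodule.span ℂ (Set.range u)) := by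
  set W := Submodule.span ℂ (Set.range u)
  let b := stdOrthonormalBasis ℂ W
  -- The sum on the right is the `i`-th diagonal entry of the orthogonal projection onto `W`; over
  -- all `i` these add up to its trace, `dim W`.
  have key : ∀ i, δ ^ 2 ≤ M * ∑ j, ‖(b j : EuclideanSpace ℂ I) i‖ ^ 2 := by
    intro i
    let v : W := ⟨u i, Submodule.subset_span ⟨i, rfl⟩⟩
    have h1 : u i i = ∑ j, inner ℂ (b j) v * (b j : EuclideanSpace ℂ I) i := by
      have h := congrArg (fun z : W => (z : EuclideanSpace ℂ I) i) (b.sum_repr' v)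
      simpa [v] using h.symm
    have h2 : ∑ j, ‖inner ℂ (b j) v‖ ^ 2 = ‖u i‖ ^ 2 := b.sum_sq_norm_inner_right v
    calc δ ^ 2 ≤ ‖u i i‖ ^ 2 := by gcongr; exact hdiag i
      _ ≤ (∑ j, ‖inner ℂ (b j) v‖ * ‖(b j : EuclideanSpace ℂ I) i‖) ^ 2 := by
          gcongr
          rw [h1]
          exact (norm_sum_le _ _).trans (by simp)
      _ ≤ (∑ j, ‖inner ℂ (b j) v‖ ^ 2) * ∑ j, ‖(b j : EuclideanSpace ℂ I) i‖ ^ 2 :=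
          Finset.sum_mul_sq_le_sq_mul_sq _ _ _
      _ ≤ _ := by
          rw [h2]
          gcongr
          exact hM i
  calc δ ^ 2 * Fintype.card I = ∑ _i : I, δ ^ 2 := by simp [mul_comm]
    _ ≤ ∑ i, M * ∑ j, ‖(b j : EuclideanSpace ℂ I) i‖ ^ 2 := Finset.sum_le_sum fun i _ => key i
    _ = M * ∑ j, ‖(b j : EuclideanSpace ℂ I)‖ ^ 2 := by
        rw [← Finset.mul_sum, Finset.sum_comm]
        simp only [EuclideanSpace.norm_sq_eq]
    _ = _ := by
        have : ∀ j, ‖(b j : EuclideanSpace ℂ I)‖ = 1 := fun j => b.orthonormal.1 j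
        simp [this]

/-- Cubes in `ι → ℤ` are asymptotically invariant under translation by a bounded set. -/
theorem exists_nested_boxes {ι κ : Type*} [Fintype ι] [DecidableEq ι] [Finite κ] (x : κ → ι → ℤ)
    {ε : ℝ} (hε : 0 < ε) :
    ∃ I Ω T : Finset (ι → ℤ), Ω.Nonempty ∧ I ⊆ T ∧ (∀ k, ∀ v ∈ Ω, v + x k ∈ T) ∧
      (∀ k, ∀ v ∈ I, v - x k ∈ Ω) ∧ ((T \ I).card : ℝ) ≤ ε * Ω.card := by
  obtain ⟨R, hR⟩ : ∃ R : ℕ, ∀ k i, |x k i| ≤ R := by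
    obtain ⟨R, hR⟩ := (Set.finite_range fun p : κ × ι => (x p.1 p.2).natAbs).bddAbove
    refine ⟨R, fun k i => ?_⟩
    rw [Int.abs_eq_natAbs]
    exact_mod_cast hR ⟨(k, i), rfl⟩
  let B : ℕ → Finset (ι → ℤ) := fun L => Finset.Icc (fun _ => -(L : ℤ)) (fun _ => (L : ℤ))
  have hB : ∀ L v, v ∈ B L ↔ ∀ i, |v i| ≤ L := by
    intro L v
    simp only [B, Finset.mem_Icc, Pi.le_def, abs_le]
    exact ⟨fun h i => ⟨h.1 i, h.2 i⟩, fun h => ⟨fun i => (h i).1, fun i => (h i).2⟩⟩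
  have hcard : ∀ L, ((B L).card : ℝ) = (2 * L + 1) ^ Fintype.card ι := by
    intro L
    have : ((L : ℤ) + 1 + L).toNat = 2 * L + 1 := by omega
    simp [B, Pi.card_Icc, this]
  have hmono : ∀ L L', L ≤ L' → B L ⊆ B L' := by
    intro L L' h v hv
    rw [hB] at hv ⊢
    exact fun i => (hv i).trans (by exact_mod_cast h)
  have hlim : Filter.Tendsto
      (fun K : ℕ => (1 + 4 * (R : ℝ) / (2 * K + 1)) ^ Fintype.card ι) Filter.atTop (nhds 1) := by
    have h1 : Filter.Tendsto (fun K : ℕ => 4 * (R : ℝ) / (2 * K + 1)) Filter.atTop (nhds 0) := by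
      apply Filter.Tendsto.div_atTop tendsto_const_nhds
      exact Filter.tendsto_atTop_add_const_right _ _
        (tendsto_natCast_atTop_atTop.const_mul_atTop (by norm_num))
    simpa using (h1.const_add 1).pow (Fintype.card ι)
  -- The side ratio of the boxes of radius `K + 2R` and `K` is `1 + 4R / (2K + 1)`.
  obtain ⟨K, hK⟩ := (hlim.eventually (gt_mem_nhds (lt_add_of_pos_right 1 hε))).exists
  refine ⟨B K, B (K + R), B (K + 2 * R), ⟨0, by simp only [hB]; intro i; simp; positivity⟩,
    hmono _ _ (by omega), ?_, ?_, ?_⟩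
  · intro k v hv
    rw [hB] at hv ⊢
    intro i
    have := abs_add_le (v i) (x k i)
    have := hv i
    have := hR k i
    simp only [Pi.add_apply]
    push_cast at *
    linarith
  · intro k v hv
    rw [hB] at hv ⊢
    intro i
    have := abs_sub (v i) (x k i)
    have := hv i
    have := hR k i
    simp only [Pi.sub_apply]
    push_cast at *
    linarith
  · rw [Finset.cast_card_sdiff (hmono _ _ (by omega))]
    have h1 : ((B (K + 2 * R)).card : ℝ) ≤ (1 + ε) * (B K).card := by
      rw [hcard, hcard]
      have hpos : (0 : ℝ) < 2 * K + 1 := by positivity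
      calc _ = ((1 + 4 * (R : ℝ) / (2 * K + 1)) * (2 * K + 1)) ^ Fintype.card ι := by
            congr 1
            push_cast
            field_simp
            ring
        _ ≤ _ := by
            rw [mul_pow]
            gcongr
    have h2 : ((B K).card : ℝ) ≤ (B (K + R)).card := by
      exact_mod_cast Finset.card_le_card (hmono _ _ (by omega))
    nlinarith

/-- Convolution by a finitely supported function, twisted by `s`. -/
def twistedConv {G κ : Type*} [AddCommGroup G] [Fintype κ] (s : G → G → ℂ) (c : κ → ℂ)
    (x : κ → G) : (G → ℂ) →ₗ[ℂ] (G → ℂ) where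
  toFun w μ := ∑ k, c k * s (x k) (μ - x k) * w (μ - x k)
  map_add' v w := by ext μ; simp [mul_add, Finset.sum_add_distrib]
  map_smul' a w := by
    ext μ
    simp only [Pi.smul_apply, smul_eq_mul, Finset.mul_sum, RingHom.id_apply]
    exact Finset.sum_congr rfl fun k _ => by ring

/-- The twisted group ring of a group with unique sums has no zero divisors. -/
theorem eq_zero_of_twistedConv_eq_zero_of_finite {G κ : Type*} [AddCommGroup G] [UniqueSums G]
    [Fintype κ] [Nonempty κ] {s : G → G → ℂ} (hs : ∀ u v, s u v ≠ 0) {c : κ → ℂ}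
    (hc : ∀ k, c k ≠ 0) {x : κ → G} (hx : Function.Injective x) {w : G → ℂ}
    (hw : w.support.Finite) (h : twistedConv s c x w = 0) : w = 0 := by
  classical
  by_contra hne
  have hB : hw.toFinset.Nonempty := by
    obtain ⟨v, hv⟩ := Function.ne_iff.1 hne
    exact ⟨v, by simpa using hv⟩
  obtain ⟨p, hp, q, hq, hu⟩ := UniqueSums.uniqueAdd_of_nonempty
    (A := Finset.univ.image x) (Finset.univ_nonempty.image x) hB
  obtain ⟨k, -, rfl⟩ := Finset.mem_image.1 hp
  -- At a point that is a sum in only one way, the convolution has a single nonzero term.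
  have h0 := congrFun h (x k + q)
  simp only [twistedConv, LinearMap.coe_mk, AddHom.coe_mk, Pi.zero_apply] at h0
  rw [Finset.sum_eq_single k] at h0
  · rw [add_sub_cancel_left] at h0
    exact mul_ne_zero (mul_ne_zero (hc k) (hs _ _)) (by simpa using hq) h0
  · intro j _ hj
    have : w (x k + q - x j) = 0 := by
      by_contra hwj
      exact hj (hx (hu (Finset.mem_image_of_mem x (Finset.mem_univ j))
        (by simpa using hwj) (add_sub_cancel _ _)).1)
    rw [this, mul_zero]
  · simp

/-- Extension by zero of functions on a finite set. -/
def extendByZero {G : Type*} [DecidableEq G] (Ω : Finset G) :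
    EuclideanSpace ℂ Ω →ₗ[ℂ] (G → ℂ) where
  toFun w v := if h : v ∈ Ω then w ⟨v, h⟩ else 0
  map_add' w w' := by ext v; by_cases h : v ∈ Ω <;> simp [h]
  map_smul' a w := by ext v; by_cases h : v ∈ Ω <;> simp [h]

/-- A finitely supported nonzero function on `ι → ℤ` is not a left zero divisor in `ℓ²` for
convolution twisted by a unimodular cocycle. -/
theorem eq_zero_of_twistedConv_eq_zero {ι κ : Type*} [Fintype ι] [Fintype κ] [Nonempty κ]
    {s : (ι → ℤ) → (ι → ℤ) → ℂ} (hs : ∀ u v, ‖s u v‖ = 1)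
    (hcoc : ∀ u v w, s u v * s (u + v) w = s u (v + w) * s v w)
    {c : κ → ℂ} (hc : ∀ k, c k ≠ 0) {x : κ → ι → ℤ} (hx : Function.Injective x)
    {F : (ι → ℤ) → ℂ} (hF : Summable fun v => ‖F v‖ ^ 2) (h : twistedConv s c x F = 0) :
    F = 0 := by
  classical
  by_contra hne
  obtain ⟨p, hp⟩ := Function.ne_iff.1 hne
  set M := ∑' v, ‖F v‖ ^ 2
  have hδ : 0 < ‖F p‖ := norm_pos_iff.2 hp
  have hM : 0 < M := (pow_pos hδ 2).trans_le
    (hF.le_tsum p fun _ _ => by positivity)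
  -- This `ε` makes the boundary layer at most half the rank bound `‖F p‖² |Ω| / M`.
  obtain ⟨I, Ω, T, hΩ, hIT, hΩT, hIΩ, hcard⟩ :=
    exists_nested_boxes x (ε := ‖F p‖ ^ 2 / (2 * M)) (by positivity)
  -- twisted translates of `F`
  let U : (ι → ℤ) → (ι → ℤ) → ℂ := fun ν v => s (v - (ν - p)) (ν - p) * F (v - (ν - p))
  -- By the cocycle identity, twisted translation on the right commutes with convolution on the
  -- left. The offset `ν - p` puts `F p` on the diagonal.
  have hU : ∀ ν, twistedConv s c x (U ν) = 0 := by
    intro ν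
    ext μ
    have h0 := congrFun h (μ - (ν - p))
    simp only [twistedConv, LinearMap.coe_mk, AddHom.coe_mk, Pi.zero_apply] at h0 ⊢
    rw [← mul_zero (s (μ - (ν - p)) (ν - p)), ← h0, Finset.mul_sum]
    refine Finset.sum_congr rfl fun k _ => ?_
    have hc := hcoc (x k) (μ - (ν - p) - x k) (ν - p)
    rw [add_sub_cancel, sub_right_comm, sub_add_cancel] at hc
    simp only [U]
    rw [sub_right_comm μ (ν - p) (x k), mul_assoc (c k), ← mul_assoc (s (x k) _) , ← hc]
    ring
  let u : Ω → EuclideanSpace ℂ Ω := fun ν => WithLp.toLp 2 fun v => U ν v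
  have hdiag : ∀ ν, ‖F p‖ ≤ ‖u ν ν‖ := by
    intro ν
    simp [u, U, hs]
  have hrow : ∀ ν, ‖u ν‖ ^ 2 ≤ M := by
    intro ν
    rw [EuclideanSpace.norm_sq_eq]
    have hs' : Summable fun v => ‖U ν v‖ ^ 2 := by
      simp only [U, norm_mul, hs, one_mul]
      exact (Equiv.subRight ((ν : ι → ℤ) - p)).summable_iff.2 hF
    have ht : ∑' v, ‖U ν v‖ ^ 2 = M := by
      simp only [U, norm_mul, hs, one_mul]
      exact (Equiv.subRight ((ν : ι → ℤ) - p)).tsum_eq fun v => ‖F v‖ ^ 2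
    rw [← ht]
    refine le_trans (le_of_eq ?_) (hs'.sum_le_tsum Ω fun _ _ => by positivity)
    exact Finset.sum_coe_sort Ω fun v => ‖U ν v‖ ^ 2
  have hrank := sq_mul_card_le_mul_finrank_span u hδ.le hdiag hrow
  set W := Submodule.span ℂ (Set.range u)
  let Φ : EuclideanSpace ℂ Ω →ₗ[ℂ] ((ι → ℤ) → ℂ) := twistedConv s c x ∘ₗ extendByZero Ω
  let Ψ : W →ₗ[ℂ] (↥(T \ I) → ℂ) :=
    LinearMap.funLeft ℂ ℂ (Subtype.val : ↥(T \ I) → ι → ℤ) ∘ₗ Φ ∘ₗ W.subtype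
  have hΩpos : (0 : ℝ) < Ω.card := by exact_mod_cast hΩ.card_pos
  have hlt : (T \ I).card < Module.finrank ℂ W := by
    have h1 : ‖F p‖ ^ 2 * Ω.card ≤ M * Module.finrank ℂ W := by simpa using hrank
    have h2 : M * (T \ I).card ≤ ‖F p‖ ^ 2 * Ω.card / 2 := by
      calc M * ((T \ I).card : ℝ) ≤ M * (‖F p‖ ^ 2 / (2 * M) * Ω.card) := by gcongr
        _ = _ := by field_simp
    have h3 : M * (T \ I).card < M * Module.finrank ℂ W := by
      have : 0 < ‖F p‖ ^ 2 * Ω.card := by positivity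
      linarith
    exact_mod_cast lt_of_mul_lt_mul_left h3 hM.le
  obtain ⟨w, hw, hw0⟩ := Submodule.exists_mem_ne_zero_of_ne_bot
    (LinearMap.ker_ne_bot_of_finrank_lt (f := Ψ) (by simpa using hlt))
  -- The convolution at `μ ∈ I` only reads values in `Ω`, so the cut-off is not felt there.
  have hΦI : ∀ μ ∈ I, ∀ z ∈ W, Φ z μ = 0 := by
    intro μ hμ z hz
    induction hz using Submodule.span_induction with
    | mem z hz =>
      obtain ⟨ν, rfl⟩ := hz
      refine Eq.trans ?_ (congrFun (hU ν) μ)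
      simp only [Φ, twistedConv, extendByZero, LinearMap.comp_apply, LinearMap.coe_mk,
        AddHom.coe_mk]
      refine Finset.sum_congr rfl fun k _ => ?_
      rw [dif_pos (hIΩ k μ hμ)]
    | zero => simp
    | add a b _ _ ha hb => rw [map_add, Pi.add_apply, ha, hb, add_zero]
    | smul t a _ ha => rw [map_smul, Pi.smul_apply, ha, smul_zero]
  have hΦ : twistedConv s c x (extendByZero Ω (w : EuclideanSpace ℂ Ω)) = 0 := by
    ext μ
    by_cases hI : μ ∈ I
    · exact hΦI μ hI w w.2
    by_cases hT : μ ∈ T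
    · exact congrFun (LinearMap.mem_ker.1 hw) ⟨μ, Finset.mem_sdiff.2 ⟨hT, hI⟩⟩
    · simp only [twistedConv, extendByZero, LinearMap.coe_mk, AddHom.coe_mk, Pi.zero_apply]
      refine Finset.sum_eq_zero fun k _ => ?_
      rw [dif_neg, mul_zero]
      intro hk
      exact hT (by simpa using hΩT k _ hk)
  have hz := eq_zero_of_twistedConv_eq_zero_of_finite
    (fun u v => norm_pos_iff.1 (by rw [hs]; exact one_pos)) hc hx
    (Ω.finite_toSet.subset fun v hv => by
      by_contra hvΩ
      exact hv (dif_neg hvΩ)) hΦ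
  refine hw0 (Subtype.ext ?_)
  ext v
  have := congrFun hz v
  simpa [extendByZero] using this

/-! ### Bessel sequences and Gaussian sums over lattices -/

/-- Schur's test: a family whose Gram matrix has bounded absolute row sums is a Bessel
sequence. -/
theorem summable_sq_norm_inner_of_gram_le {α H : Type*} [NormedAddCommGroup H]
    [InnerProductSpace ℂ H] {g : α → H} {C : ℝ}
    (hC0 : 0 ≤ C) (hC : ∀ i, ∀ S : Finset α, ∑ j ∈ S, ‖inner ℂ (g i) (g j)‖ ≤ C) (f : H) :
    Summable fun i => ‖inner ℂ (g i) f‖ ^ 2 := by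
  refine summable_of_sum_le (c := C * ‖f‖ ^ 2) (fun _ => by positivity) fun S => ?_
  set X := ∑ i ∈ S, ‖inner ℂ (g i) f‖ ^ 2 with hX
  have hX0 : 0 ≤ X := Finset.sum_nonneg fun _ _ => by positivity
  rcases hX0.eq_or_lt with h0 | hpos
  · rw [← h0]
    positivity
  let a : α → ℂ := fun i => inner ℂ (g i) f
  -- Duality: `⟪v, f⟫ = X`, while `‖v‖² ≤ C X` by AM-GM and the symmetry of the absolute Gram
  -- matrix.
  set v := ∑ i ∈ S, a i • g i with hv
  have h1 : X ≤ ‖v‖ * ‖f‖ := by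
    have : inner ℂ v f = (X : ℂ) := by
      rw [hv, sum_inner, hX]
      push_cast
      refine Finset.sum_congr rfl fun i _ => ?_
      rw [inner_smul_left]
      exact Complex.conj_mul' _
    calc X = ‖inner ℂ v f‖ := by rw [this, Complex.norm_real, Real.norm_of_nonneg hX0]
      _ ≤ _ := norm_inner_le_norm _ _
  have h2 : ‖v‖ ^ 2 ≤ C * X := by
    have e : ‖v‖ ^ 2 = ‖inner ℂ v v‖ := by
      rw [inner_self_eq_norm_sq_to_K]; simp
    have hsym : ∀ i j, ‖inner ℂ (g i) (g j)‖ = ‖inner ℂ (g j) (g i)‖ := fun i j =>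
      norm_inner_symm _ _
    have hrow : ∑ i ∈ S, ∑ j ∈ S, ‖a i‖ ^ 2 * ‖inner ℂ (g i) (g j)‖ ≤ C * X := by
      rw [hX, Finset.mul_sum]
      refine Finset.sum_le_sum fun i _ => ?_
      rw [← Finset.mul_sum, mul_comm]
      exact mul_le_mul_of_nonneg_right (hC i S) (by positivity)
    have hcol : ∑ i ∈ S, ∑ j ∈ S, ‖a j‖ ^ 2 * ‖inner ℂ (g i) (g j)‖ ≤ C * X := by
      rw [Finset.sum_comm]
      simpa only [hsym] using hrow
    calc ‖v‖ ^ 2 ≤ ∑ i ∈ S, ∑ j ∈ S, ‖a i‖ * ‖a j‖ * ‖inner ℂ (g i) (g j)‖ := by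
          rw [e, hv, sum_inner]
          refine (norm_sum_le _ _).trans (Finset.sum_le_sum fun i _ => ?_)
          rw [inner_sum]
          refine (norm_sum_le _ _).trans (Finset.sum_le_sum fun j _ => ?_)
          rw [inner_smul_left, inner_smul_right, norm_mul, norm_mul, RCLike.norm_conj, mul_assoc]
      _ ≤ ∑ i ∈ S, ∑ j ∈ S, (‖a i‖ ^ 2 * ‖inner ℂ (g i) (g j)‖ / 2
            + ‖a j‖ ^ 2 * ‖inner ℂ (g i) (g j)‖ / 2) := by
          refine Finset.sum_le_sum fun i _ => Finset.sum_le_sum fun j _ => ?_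
          have := mul_le_mul_of_nonneg_right (two_mul_le_add_sq ‖a i‖ ‖a j‖)
            (norm_nonneg (inner ℂ (g i) (g j)))
          linarith
      _ = (∑ i ∈ S, ∑ j ∈ S, ‖a i‖ ^ 2 * ‖inner ℂ (g i) (g j)‖) / 2
            + (∑ i ∈ S, ∑ j ∈ S, ‖a j‖ ^ 2 * ‖inner ℂ (g i) (g j)‖) / 2 := by
          simp only [Finset.sum_add_distrib, Finset.sum_div]
      _ ≤ C * X := by linarith
  have h3 : X ^ 2 ≤ C * X * ‖f‖ ^ 2 := by
    calc X ^ 2 ≤ (‖v‖ * ‖f‖) ^ 2 := by gcongr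
      _ = ‖v‖ ^ 2 * ‖f‖ ^ 2 := by ring
      _ ≤ _ := by gcongr
  have h4 : X * X ≤ X * (C * ‖f‖ ^ 2) := by linarith
  exact le_of_mul_le_mul_left h4 hpos

/-- A Gaussian is summable over a discrete subgroup. -/
theorem summable_exp_neg_mul_sq_norm {E : Type*} [NormedAddCommGroup E] [NormedSpace ℝ E]
    [FiniteDimensional ℝ E] (L : Submodule ℤ E) [DiscreteTopology L] {c : ℝ} (hc : 0 < c) :
    Summable fun z : L => Real.exp (-(c * ‖z‖ ^ 2)) := by
  set k := Module.finrank ℤ L + 1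
  have h := (ZLattice.summable_norm_pow_inv L (2 * k) (by omega)).mul_left (k.factorial / c ^ k)
  refine h.of_norm_bounded_eventually ?_
  -- The comparison fails at `z = 0`, where `0⁻¹ = 0`.
  have : ∀ᶠ z : L in Filter.cofinite, z ≠ 0 := by
    simp [Filter.eventually_cofinite]
  filter_upwards [this] with z hz
  have hz' : 0 < ‖z‖ := norm_pos_iff.2 hz
  rw [Real.norm_of_nonneg (Real.exp_pos _).le, Real.exp_neg]
  have := Real.pow_div_factorial_le_exp (c * ‖z‖ ^ 2) (by positivity) k
  calc (Real.exp (c * ‖z‖ ^ 2))⁻¹ ≤ ((c * ‖z‖ ^ 2) ^ k / k.factorial)⁻¹ := by gcongr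
    _ = _ := by
      rw [mul_pow, ← pow_mul, inv_pow]
      field_simp

/-! ### Time-frequency shifts of the Gaussian -/

section Gaussian

variable {V : Type*} [NormedAddCommGroup V] [InnerProductSpace ℝ V]

/-- The character `t ↦ exp (2πi θ)` of the real line. -/
noncomputable def phase (θ : ℝ) : ℂ := Complex.exp (2 * (Real.pi : ℂ) * Complex.I * (θ : ℂ))

theorem phase_add (θ η : ℝ) : phase (θ + η) = phase θ * phase η := by
  rw [phase, phase, phase, ← Complex.exp_add]
  push_cast
  ring_nf

theorem norm_phase (θ : ℝ) : ‖phase θ‖ = 1 := by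
  have : 2 * (Real.pi : ℂ) * Complex.I * (θ : ℂ) = ((2 * Real.pi * θ : ℝ) : ℂ) * Complex.I := by
    push_cast; ring
  rw [phase, this, Complex.norm_exp_ofReal_mul_I]

theorem conj_phase (θ : ℝ) : (starRingEnd ℂ) (phase θ) = phase (-θ) := by
  rw [phase, phase, ← Complex.exp_conj]
  simp [Complex.conj_ofNat]

theorem continuous_phase : Continuous phase := by
  unfold phase
  fun_prop

/-- The Gaussian translated by `-p.1` and modulated by `p.2`. -/
noncomputable def gaussianShift (p : V × V) (t : V) : ℂ :=
  phase (inner ℝ p.2 t) * (Real.exp (-(Real.pi * ‖t + p.1‖ ^ 2)) : ℝ)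

theorem continuous_gaussianShift (p : V × V) : Continuous (gaussianShift p) := by
  unfold gaussianShift
  refine (continuous_phase.comp (by fun_prop)).mul ?_
  exact Complex.continuous_ofReal.comp (by fun_prop)

theorem norm_gaussianShift (p : V × V) (t : V) :
    ‖gaussianShift p t‖ = Real.exp (-(Real.pi * ‖t + p.1‖ ^ 2)) := by
  rw [gaussianShift, norm_mul, norm_phase, one_mul, Complex.norm_real,
    Real.norm_of_nonneg (Real.exp_pos _).le]

variable [FiniteDimensional ℝ V] [MeasurableSpace V] [BorelSpace V]

theorem memLp_gaussianShift (p : V × V) : MemLp (gaussianShift p) 2 (volume : Measure V) := by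
  rw [memLp_two_iff_integrable_sq_norm (continuous_gaussianShift p).aestronglyMeasurable]
  have h := (GaussianFourier.integrable_cexp_neg_mul_sq_norm_add (V := V) (b := 2 * Real.pi)
    (by simp [Real.pi_pos]) 0 0).norm.comp_add_right p.1
  refine h.congr (Filter.Eventually.of_forall fun t => ?_)
  simp only [norm_gaussianShift, Complex.norm_exp]
  rw [← Real.exp_nat_mul]
  congr 1
  simp [← Complex.ofReal_pow]
  ring

/-- Gaussian decay of the Gram matrix of the time-frequency shifts of a Gaussian. -/
theorem norm_integral_conj_gaussianShift_mul_le :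
    ∃ K : ℝ, 0 ≤ K ∧ ∀ p q : V × V,
      ‖∫ t, (starRingEnd ℂ) (gaussianShift p t) * gaussianShift q t‖ ≤
        K * Real.exp (-(Real.pi / 2 * ‖p - q‖ ^ 2)) := by
  refine ⟨‖((Real.pi : ℂ) / (2 * Real.pi)) ^ (Module.finrank ℝ V / 2 : ℂ)‖, norm_nonneg _,
    fun p q => ?_⟩
  -- Centring at the midpoint lets the parallelogram law split off the decay in `p.1 - q.1`; the
  -- Fourier transform of the remaining Gaussian gives the decay in `p.2 - q.2`.
  set m : V := (1 / 2 : ℝ) • (p.1 + q.1) with hm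
  have hpt : ∀ t, (starRingEnd ℂ) (gaussianShift p (t - m)) * gaussianShift q (t - m) =
      phase (inner ℝ (q.2 - p.2) (-m)) * (Real.exp (-(Real.pi / 2 * ‖p.1 - q.1‖ ^ 2)) : ℝ) *
      Complex.exp (-(2 * Real.pi : ℂ) * ‖t‖ ^ 2 +
        2 * Real.pi * Complex.I * (inner ℝ (q.2 - p.2) t : ℝ)) := by
    intro t
    have h1 : ‖t - m + p.1‖ ^ 2 + ‖t - m + q.1‖ ^ 2 = 2 * ‖t‖ ^ 2 + ‖p.1 - q.1‖ ^ 2 / 2 := by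
      have e1 : t - m + p.1 = t + (1 / 2 : ℝ) • (p.1 - q.1) := by rw [hm]; module
      have e2 : t - m + q.1 = t - (1 / 2 : ℝ) • (p.1 - q.1) := by rw [hm]; module
      have := parallelogram_law_with_norm ℝ t ((1 / 2 : ℝ) • (p.1 - q.1))
      rw [e1, e2]
      rw [norm_smul] at this
      norm_num at this
      linarith
    have h2 : Real.exp (-(Real.pi * ‖t - m + p.1‖ ^ 2)) * Real.exp (-(Real.pi * ‖t - m + q.1‖ ^ 2))
        = Real.exp (-(Real.pi / 2 * ‖p.1 - q.1‖ ^ 2)) * Real.exp (-(2 * Real.pi) * ‖t‖ ^ 2) := by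
      rw [← Real.exp_add, ← Real.exp_add]
      congr 1
      linear_combination (-Real.pi) * h1
    have h3 : phase (-inner ℝ p.2 (t - m)) * phase (inner ℝ q.2 (t - m)) =
        phase (inner ℝ (q.2 - p.2) (-m)) * phase (inner ℝ (q.2 - p.2) t) := by
      rw [← phase_add, ← phase_add]
      congr 1
      simp only [inner_sub_left, inner_sub_right, inner_neg_right]
      ring
    have h2' := congrArg (fun x : ℝ => (x : ℂ)) h2
    simp only [Complex.ofReal_mul] at h2'
    rw [Complex.exp_add]
    have h4 : Complex.exp (-(2 * Real.pi : ℂ) * ‖t‖ ^ 2) =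
        (Real.exp (-(2 * Real.pi) * ‖t‖ ^ 2) : ℝ) := by push_cast; rfl
    rw [h4]
    change _ = _ * (_ * phase (inner ℝ (q.2 - p.2) t))
    simp only [gaussianShift, map_mul, conj_phase, Complex.conj_ofReal]
    linear_combination (phase (-inner ℝ p.2 (t - m)) * phase (inner ℝ q.2 (t - m))) * h2' +
      (Real.exp (-(Real.pi / 2 * ‖p.1 - q.1‖ ^ 2)) : ℂ) *
        (Real.exp (-(2 * Real.pi) * ‖t‖ ^ 2) : ℂ) * h3
  rw [← integral_sub_right_eq_self _ m]
  simp only [hpt]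
  rw [integral_const_mul, GaussianFourier.integral_cexp_neg_mul_sq_norm_add
    (by simp [Real.pi_pos]), norm_mul, norm_mul, norm_mul, norm_phase, one_mul, Complex.norm_real,
    Real.norm_of_nonneg (Real.exp_pos _).le, mul_left_comm]
  gcongr
  have h5 : (2 * Real.pi * Complex.I) ^ 2 * (‖q.2 - p.2‖ : ℂ) ^ 2 / (4 * (2 * Real.pi)) =
      ((-(Real.pi / 2 * ‖p.2 - q.2‖ ^ 2) : ℝ) : ℂ) := by
    have : (Real.pi : ℂ) ≠ 0 := by exact_mod_cast Real.pi_ne_zero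
    rw [norm_sub_rev q.2 p.2]
    push_cast
    field_simp
    rw [Complex.I_sq]
    ring
  rw [h5, Complex.norm_exp, Complex.ofReal_re, ← Real.exp_add, Real.exp_le_exp]
  have h6 : ‖p - q‖ ^ 2 ≤ ‖p.1 - q.1‖ ^ 2 + ‖p.2 - q.2‖ ^ 2 := by
    rw [Prod.norm_def]
    rcases max_choice ‖(p - q).1‖ ‖(p - q).2‖ with h | h <;> rw [h] <;>
      simp only [Prod.fst_sub, Prod.snd_sub] <;>
      nlinarith [sq_nonneg ‖p.1 - q.1‖, sq_nonneg ‖p.2 - q.2‖]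
  nlinarith [Real.pi_pos]

end Gaussian

/-! ### Injectivity of the Fourier transform -/

open scoped FourierTransform ContDiff in
/-- An integrable function with vanishing Fourier transform is zero almost everywhere. -/
theorem ae_eq_zero_of_fourier_eq_zero {V : Type*} [NormedAddCommGroup V] [InnerProductSpace ℝ V]
    [FiniteDimensional ℝ V] [MeasurableSpace V] [BorelSpace V] {φ : V → ℂ} (hφ : Integrable φ)
    (h : 𝓕 φ = 0) : ∀ᵐ t, φ t = 0 := by
  refine ae_eq_zero_of_integral_contDiff_smul_eq_zero hφ.locallyIntegrable fun g hg hgc => ?_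
  have hg₁ : HasCompactSupport (Complex.ofRealCLM ∘ g) := hgc.comp_left rfl
  have hg₂ : ContDiff ℝ ∞ (Complex.ofRealCLM ∘ g) := by fun_prop
  let ψ : SchwartzMap V ℂ := hg₁.toSchwartzMap hg₂
  let χ : SchwartzMap V ℂ := 𝓕⁻ ψ
  -- Multiplication formula, tested on the inverse transform of `g`.
  have key : ∫ ξ, 𝓕 φ ξ • χ ξ = ∫ x, φ x • 𝓕 (χ : V → ℂ) x := by
    simpa using! (VectorFourier.integral_fourierIntegral_smul_eq_flip (L := innerₗ V)
      Real.continuous_fourierChar continuous_inner hφ (χ.integrable (μ := volume)))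
  have h2 : 𝓕 (χ : V → ℂ) = ψ := by
    rw [← SchwartzMap.fourier_coe, FourierTransform.fourier_fourierInv_eq]
  rw [h2] at key
  simp only [h, Pi.zero_apply, zero_smul, integral_zero] at key
  rw [key]
  exact integral_congr_ae (Filter.Eventually.of_forall fun t => by simp [ψ, mul_comm])

/-! ### The short-time Fourier transform -/

section STFT

variable {V : Type*} [NormedAddCommGroup V] [InnerProductSpace ℝ V]

/-- The cocycle of the time-frequency shifts. -/
noncomputable def shiftCocycle (p q : V × V) : ℂ := phase (inner ℝ p.1 q.2)

theorem norm_shiftCocycle (p q : V × V) : ‖shiftCocycle p q‖ = 1 := norm_phase _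

theorem shiftCocycle_add_left (p p' q : V × V) :
    shiftCocycle (p + p') q = shiftCocycle p q * shiftCocycle p' q := by
  rw [shiftCocycle, Prod.fst_add, inner_add_left, phase_add, shiftCocycle, shiftCocycle]

theorem shiftCocycle_add_right (p q q' : V × V) :
    shiftCocycle p (q + q') = shiftCocycle p q * shiftCocycle p q' := by
  rw [shiftCocycle, Prod.snd_add, inner_add_right, phase_add, shiftCocycle, shiftCocycle]

/-- Moving a time-frequency shift from one factor to the other. -/
theorem conj_gaussianShift_mul_phase_mul (p q : V × V) (f : V → ℂ) (t : V) :
    (starRingEnd ℂ) (gaussianShift q t) * (phase (inner ℝ p.2 t) * f (t + p.1)) =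
      shiftCocycle p (q - p) *
        ((starRingEnd ℂ) (gaussianShift (q - p) (t + p.1)) * f (t + p.1)) := by
  have h1 : t + p.1 + (q - p).1 = t + q.1 := by simp
  have h2 : phase (-inner ℝ q.2 t) * phase (inner ℝ p.2 t) =
      shiftCocycle p (q - p) * phase (-inner ℝ (q - p).2 (t + p.1)) := by
    rw [shiftCocycle, ← phase_add, ← phase_add]
    congr 1
    simp only [Prod.snd_sub, inner_sub_left, inner_sub_right, inner_add_right,
      real_inner_comm p.1]
    ring
  simp only [gaussianShift, map_mul, conj_phase, Complex.conj_ofReal, h1]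
  linear_combination ((Real.exp (-(Real.pi * ‖t + q.1‖ ^ 2)) : ℝ) : ℂ) * f (t + p.1) * h2

variable [FiniteDimensional ℝ V] [MeasurableSpace V] [BorelSpace V]

/-- The short-time Fourier transform with Gaussian window. -/
noncomputable def stft (f : V → ℂ) (p : V × V) : ℂ :=
  ∫ t, (starRingEnd ℂ) (gaussianShift p t) * f t

theorem integrable_conj_gaussianShift_mul {f : V → ℂ} (hf : MemLp f 2 volume) (p : V × V) :
    Integrable fun t => (starRingEnd ℂ) (gaussianShift p t) * f t :=
  (memLp_gaussianShift p).star.integrable_mul hf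

theorem inner_toLp_gaussianShift (p : V × V) (f : Lp ℂ 2 (volume : Measure V)) :
    inner ℂ ((memLp_gaussianShift p).toLp) f = stft f p := by
  rw [L2.inner_def, stft]
  refine integral_congr_ae ?_
  filter_upwards [(memLp_gaussianShift p).coeFn_toLp] with t ht
  rw [ht, RCLike.inner_apply, mul_comm]

/-- The short-time Fourier transform is injective. -/
theorem ae_eq_zero_of_stft_eq_zero {f : V → ℂ} (hf : MemLp f 2 volume)
    (h : ∀ p, stft f p = 0) : ∀ᵐ t, f t = 0 := by
  -- The transform at `(0, w)` is the Fourier transform at `w` of `f` times a nowhere vanishing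
  -- Gaussian.
  have hφ := integrable_conj_gaussianShift_mul hf 0
  have h0 := ae_eq_zero_of_fourier_eq_zero hφ (by
    ext w
    rw [Real.fourier_eq', Pi.zero_apply, ← h (0, w), stft]
    refine integral_congr_ae (Filter.Eventually.of_forall fun t => ?_)
    have hw : Complex.exp (((-2 * Real.pi * inner ℝ t w : ℝ) : ℂ) * Complex.I) =
        phase (-inner ℝ w t) := by
      rw [phase, real_inner_comm]
      congr 1
      push_cast
      ring
    have h0 : phase 0 = 1 := by simp [phase]
    simp only [gaussianShift, map_mul, conj_phase, Complex.conj_ofReal, Prod.fst_zero,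
      Prod.snd_zero, inner_zero_left, smul_eq_mul, hw, h0, map_one]
    ring)
  filter_upwards [h0] with t ht
  refine (mul_eq_zero.1 ht).resolve_left ?_
  rw [← ne_eq, map_ne_zero, ← norm_pos_iff, norm_gaussianShift]
  exact Real.exp_pos _

/-- The short-time Fourier transform of a square integrable function is square summable over the
translates of a discrete subgroup. -/
theorem summable_sq_norm_stft (L : Submodule ℤ (V × V)) [DiscreteTopology L] (z : V × V)
    (f : Lp ℂ 2 (volume : Measure V)) : Summable fun v : L => ‖stft f (z + v)‖ ^ 2 := by
  obtain ⟨K, hK, hgram⟩ := norm_integral_conj_gaussianShift_mul_le (V := V)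
  have hsum := summable_exp_neg_mul_sq_norm L (c := Real.pi / 2) (by positivity)
  have hnonneg : ∀ v : L, 0 ≤ Real.exp (-(Real.pi / 2 * ‖v‖ ^ 2)) := fun _ => (Real.exp_pos _).le
  simp only [← inner_toLp_gaussianShift]
  refine summable_sq_norm_inner_of_gram_le
    (C := K * ∑' v : L, Real.exp (-(Real.pi / 2 * ‖v‖ ^ 2)))
    (mul_nonneg hK (tsum_nonneg hnonneg)) (fun v S => ?_) f
  have hterm : ∀ w : L, ‖inner ℂ ((memLp_gaussianShift (z + (v : V × V))).toLp)
      ((memLp_gaussianShift (z + (w : V × V))).toLp)‖ ≤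
        K * Real.exp (-(Real.pi / 2 * ‖v - w‖ ^ 2)) := by
    intro w
    have e : stft ((memLp_gaussianShift (z + (w : V × V))).toLp) (z + (v : V × V)) =
        ∫ t, (starRingEnd ℂ) (gaussianShift (z + (v : V × V)) t) *
          gaussianShift (z + (w : V × V)) t := by
      refine integral_congr_ae ?_
      filter_upwards [(memLp_gaussianShift (z + (w : V × V))).coeFn_toLp] with t ht
      rw [ht]
    rw [inner_toLp_gaussianShift, e]
    have := hgram (z + (v : V × V)) (z + (w : V × V))
    rwa [add_sub_add_left_eq_sub] at this
  have hs' : Summable fun w : L => Real.exp (-(Real.pi / 2 * ‖v - w‖ ^ 2)) :=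
    (Equiv.subLeft v).summable_iff.2 hsum
  have ht : ∑' w : L, Real.exp (-(Real.pi / 2 * ‖v - w‖ ^ 2)) =
      ∑' w : L, Real.exp (-(Real.pi / 2 * ‖w‖ ^ 2)) :=
    (Equiv.subLeft v).tsum_eq fun w : L => Real.exp (-(Real.pi / 2 * ‖w‖ ^ 2))
  calc _ ≤ ∑ w ∈ S, K * Real.exp (-(Real.pi / 2 * ‖v - w‖ ^ 2)) :=
        Finset.sum_le_sum fun w _ => hterm w
    _ ≤ _ := by
      rw [← Finset.mul_sum, ← ht]
      exact mul_le_mul_of_nonneg_left (hs'.sum_le_tsum S fun _ _ => (Real.exp_pos _).le) hK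

/-- A linear dependency between time-frequency shifts of `f` is a twisted convolution equation for
its short-time Fourier transform. -/
theorem sum_shiftCocycle_mul_stft_eq_zero {κ : Type*} [Fintype κ] {c : κ → ℂ} {p : κ → V × V}
    {f : V → ℂ} (hf : MemLp f 2 volume)
    (h : ∀ᵐ t, ∑ k, c k * phase (inner ℝ (p k).2 t) * f (t + (p k).1) = 0) (q : V × V) :
    ∑ k, c k * shiftCocycle (p k) (q - p k) * stft f (q - p k) = 0 := by
  have hint : ∀ k, Integrable fun t => c k * shiftCocycle (p k) (q - p k) *
      ((starRingEnd ℂ) (gaussianShift (q - p k) (t + (p k).1)) * f (t + (p k).1)) := fun k =>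
    ((integrable_conj_gaussianShift_mul hf (q - p k)).comp_add_right (p k).1).const_mul _
  have hk : ∀ k, c k * shiftCocycle (p k) (q - p k) * stft f (q - p k) =
      ∫ t, c k * shiftCocycle (p k) (q - p k) *
        ((starRingEnd ℂ) (gaussianShift (q - p k) (t + (p k).1)) * f (t + (p k).1)) := by
    intro k
    rw [integral_const_mul, stft, integral_add_right_eq_self
      (fun t => (starRingEnd ℂ) (gaussianShift (q - p k) t) * f t) (p k).1]
  simp only [hk]
  rw [← integral_finsetSum _ fun k _ => hint k]
  refine integral_eq_zero_of_ae ?_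
  filter_upwards [h] with t ht
  rw [Pi.zero_apply, ← mul_zero ((starRingEnd ℂ) (gaussianShift q t)), ← ht, Finset.mul_sum]
  refine Finset.sum_congr rfl fun k _ => ?_
  rw [mul_assoc, ← conj_gaussianShift_mul_phase_mul]
  ring

end STFT

/-! ### Linear independence along a discrete subgroup -/

/-- The time-frequency shifts of `f` along the image of `ι → ℤ` are linearly independent if the
short-time Fourier transform of `f` is square summable on its translates. -/
theorem ae_eq_zero_of_summable_stft {V : Type*} [NormedAddCommGroup V]
    [InnerProductSpace ℝ V] [FiniteDimensional ℝ V] [MeasurableSpace V] [BorelSpace V]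
    {ι κ : Type*} [Fintype ι] [Fintype κ] [Nonempty κ] (E : (ι → ℤ) →+ V × V) {x : κ → ι → ℤ}
    (hx : Function.Injective x) {c : κ → ℂ} (hc : ∀ k, c k ≠ 0) {f : V → ℂ}
    (hf : MemLp f 2 volume) (hsum : ∀ z, Summable fun v => ‖stft f (z + E v)‖ ^ 2)
    (h : ∀ᵐ t, ∑ k, c k * phase (inner ℝ (E (x k)).2 t) * f (t + (E (x k)).1) = 0) :
    ∀ᵐ t, f t = 0 := by
  refine ae_eq_zero_of_stft_eq_zero hf fun z => ?_
  have hne : ∀ u v : V × V, shiftCocycle u v ≠ 0 := fun u v =>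
    norm_pos_iff.1 (by rw [norm_shiftCocycle]; exact one_pos)
  -- Bilinearity of the phase lets the dependence on the base point `z` go into the coefficients,
  -- which stay nonzero.
  have hconv : twistedConv (fun u v => shiftCocycle (E u) (E v))
      (fun k => c k * shiftCocycle (E (x k)) z) x (fun v => stft f (z + E v)) = 0 := by
    ext v
    rw [Pi.zero_apply, ← sum_shiftCocycle_mul_stft_eq_zero hf h (z + E v)]
    simp only [twistedConv, LinearMap.coe_mk, AddHom.coe_mk]
    refine Finset.sum_congr rfl fun k _ => ?_
    rw [map_sub, add_sub_assoc, shiftCocycle_add_right (E (x k)) z]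
    ring
  have hF := eq_zero_of_twistedConv_eq_zero (fun u v => norm_shiftCocycle _ _)
    (fun u v w => by
      simp only [map_add, shiftCocycle_add_left, shiftCocycle_add_right]
      ring)
    (fun k => mul_ne_zero (hc k) (hne _ _)) hx (hsum z) hconv
  simpa using congrFun hF 0

/-- A discrete subgroup of a real vector space is free of finite rank. -/
theorem exists_linearEquiv_of_discrete {E : Type*} [NormedAddCommGroup E] [NormedSpace ℝ E]
    [FiniteDimensional ℝ E] (L : Submodule ℤ E) [DiscreteTopology L] :
    ∃ m : ℕ, Nonempty ((Fin m → ℤ) ≃ₗ[ℤ] L) :=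
  ⟨_, ⟨(Module.finBasis ℤ L).equivFun.symm⟩⟩

/-- Distinct time-frequency shifts of a nonzero square integrable function along a discrete
subgroup are linearly independent. -/
theorem eq_zero_of_sum_timeFrequencyShift_eq_zero {V : Type*} [NormedAddCommGroup V]
    [InnerProductSpace ℝ V] [FiniteDimensional ℝ V] [MeasurableSpace V] [BorelSpace V]
    {κ : Type*} [Fintype κ] [Nonempty κ] (L : Submodule ℤ (V × V)) [DiscreteTopology L]
    {p : κ → V × V} (hp : Function.Injective p) (hpL : ∀ k, p k ∈ L) {c : κ → ℂ}
    (hc : ∀ k, c k ≠ 0) (f : Lp ℂ 2 (volume : Measure V))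
    (h : ∀ᵐ t, ∑ k, c k * phase (inner ℝ (p k).2 t) * f (t + (p k).1) = 0) : f = 0 := by
  rw [Lp.eq_zero_iff_ae_eq_zero]
  obtain ⟨m, ⟨e⟩⟩ := exists_linearEquiv_of_discrete L
  let E : (Fin m → ℤ) →+ V × V :=
    L.subtype.toAddMonoidHom.comp e.toLinearMap.toAddMonoidHom
  let x : κ → Fin m → ℤ := fun k => e.symm ⟨p k, hpL k⟩
  have hEx : ∀ k, E (x k) = p k := fun k =>
    congrArg Subtype.val (e.apply_symm_apply ⟨p k, hpL k⟩)
  have hx : Function.Injective x := fun j k hjk => hp (by rw [← hEx j, ← hEx k, hjk])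
  refine ae_eq_zero_of_summable_stft E hx hc (Lp.memLp f) (fun z => ?_) (by simpa only [hEx] using h)
  exact e.toEquiv.summable_iff.2 (summable_sq_norm_stft L z f)

theorem mainTheorem5 (n r : ℕ) (hr : 0 < r)
    (a b : Fin r → EuclideanSpace ℝ (Fin n))
    (hinj : Function.Injective (fun k => (a k, b k)))
    (hne : ∀ k, (a k, b k) ≠ 0)
    (hdisc : DiscreteTopology (AddSubgroup.closure (Set.range (fun k => (a k, b k)))))
    (hrat : ∀ h k, ∃ q : ℚ, inner ℝ (a h) (b k) = (q : ℝ))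
    (c : Fin r → ℂ) (hc : ∀ k, c k ≠ 0)
    (f : Lp ℂ 2 (volume : Measure (EuclideanSpace ℝ (Fin n))))
    (hf : ∀ᵐ t : EuclideanSpace ℝ (Fin n),
      ∑ k, c k * Complex.exp (2 * (Real.pi : ℂ) * Complex.I * ((inner ℝ (b k) t : ℝ) : ℂ))
        * f (t + a k) = 0) :
    f = 0 := by
  have : Nonempty (Fin r) := ⟨⟨0, hr⟩⟩
  let L := AddSubgroup.toIntSubmodule (AddSubgroup.closure (Set.range fun k => (a k, b k)))
  have : DiscreteTopology L := hdisc
  exact eq_zero_of_sum_timeFrequencyShift_eq_zero L hinj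
    (fun k => AddSubgroup.subset_closure ⟨k, rfl⟩) hc f hf
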